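/- A gauge function is a monotone increasing, right continuous function $g:[0,\infty)\to[0,\infty)$ with $g(0)=0$, and the associated Hausdorff measure on $\mathbb{R}$ is $$\mathcal{H}^g(A)=\lim_{\delta\to 0+}\ \inf\Big\{\sum_{i=1}^\infty g(\operatorname{diam} U_i)\ :\ A\subset\bigcup_{i=1}^\infty U_i,\ \operatorname{diam} U_i<\delta\Big\}.$$ A Borel set $A\subset\mathbb{R}$ is said to be measured by a Hausdorff measure if there is a gauge function $g$ such that $\mathcal{H}^g(A)>0$ and $\mathcal{H}^g$ is $\sigma$-finite on $A$ (that is, $A$ is covered by countably many Borel sets of finite $\mathcal{H}^g$ measure). Every Borel set $B\subset\mathbb{R}$ of the second category (i.e. not meagre) is a union $B=B_1\cup B_2$ of two disjoint Borel sets $B_1,B_2$, each of which is measured by a Hausdorff measure: there are gauge functions $g_1,g_2$ such that, for $i=1,2$, $\mathcal{H}^{g_i}(B_i)>0$ and $\mathcal{H}^{g_i}$ is $\sigma$-finite on $B_i$. -/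

import Mathlib

open MeasureTheory Set
open scoped NNReal ENNReal

/-- A gauge function: a monotone increasing, right continuous `g : [0, ∞) → [0, ∞)`. -/
structure IsGauge (g : ℝ≥0 → ℝ≥0) : Prop where
  mono : Monotone g
  right_cont : ∀ x, ContinuousWithinAt g (Ici x) x

/-- The Hausdorff measure `H^g` on `ℝ` with gauge function `g`, as a measure on the Borel sets:
the limit as `δ → 0+` of the infimum of `∑ g (diam (U i))` over the countable covers by sets of
diameter at most `δ`. The value of the integrand at infinite diameter plays no role, since the
measure is the supremum over all `δ > 0`. -/
noncomputable def gaugeHausdorff (g : ℝ≥0 → ℝ≥0) : Measure ℝ :=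
  Measure.mkMetric fun d : ℝ≥0∞ => (g d.toNNReal : ℝ≥0∞)

/-- For `g 0 = 0`, `gaugeHausdorff g` is given by the textbook formula. -/
theorem gaugeHausdorff_apply (g : ℝ≥0 → ℝ≥0) (h0 : g 0 = 0) (A : Set ℝ) :
    gaugeHausdorff g A =
      ⨆ (δ : ℝ≥0∞) (_ : 0 < δ), ⨅ (U : ℕ → Set ℝ) (_ : A ⊆ ⋃ i, U i)
        (_ : ∀ i, Metric.ediam (U i) ≤ δ), ∑' i, (g (Metric.ediam (U i)).toNNReal : ℝ≥0∞) := by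
  have key : ∀ t : Set ℝ, (⨆ _ : t.Nonempty, (g (Metric.ediam t).toNNReal : ℝ≥0∞)) =
      (g (Metric.ediam t).toNNReal : ℝ≥0∞) := by
    intro t
    rcases t.eq_empty_or_nonempty with rfl | h
    · simp [h0]
    · simp [h]
  rw [gaugeHausdorff, Measure.mkMetric_apply]
  simp only [key]

/-- `A` is measured by a Hausdorff measure: for some gauge function `g`, the set `A` has positive
and σ-finite `H^g`-measure. The clause `g 0 = 0` discards the degenerate gauges, for which every
infinite sum `∑ g (diam (U i))` diverges, so that no set has finite measure in the textbook
formula. -/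
def MeasuredByHausdorff (A : Set ℝ) : Prop :=
  ∃ g : ℝ≥0 → ℝ≥0, IsGauge g ∧ g 0 = 0 ∧ 0 < gaugeHausdorff g A ∧
    SigmaFinite ((gaugeHausdorff g).restrict A)

open Filter Topology

/-! If `B` has positive Lebesgue measure, it is cut at a point with positive measure on both sides;
Lebesgue measure is the Hausdorff measure of `id`.

If `B` is null, sets `I k` of diameter at most `ℓ k`, with `ℓ` summable, cover each of its points
infinitely often. Being non-meagre, `B` contains a dense Gδ set within some interval, hence room for
two disjoint Cantor sets. Each carries a gauge with positive finite measure
(`gaugeHausdorff_limitSet_pos`, `gaugeHausdorff_limitSet_le`), and the branching number `N n`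
controls how far down the gauge stays below a fixed linear function (`gauge_le_density_mul`).

The two constructions alternate (`exists_interleaved`): the indices `k` fall into consecutive
blocks, even blocks lying in linear ranges of the first gauge and odd ones in those of the second,
each starting so late that the gauges have a finite sum. Points covered by infinitely many even
blocks are null for the first gauge, by infinitely many odd blocks for the second; every point of
`B` is of one kind or the other. Each part of `B` is then a Cantor set plus a null set of its own
gauge. -/

/-! ### Gauges as infima of ramps -/

/-- The infimum of the ramps `x ↦ max (a n) (K n * x)`. -/
noncomputable def rampGauge (a K : ℕ → ℝ≥0) (x : ℝ≥0) : ℝ≥0 := ⨅ n, max (a n) (K n * x)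

theorem rampGauge_le (a K : ℕ → ℝ≥0) (x : ℝ≥0) (n : ℕ) :
    rampGauge a K x ≤ max (a n) (K n * x) :=
  ciInf_le (OrderBot.bddBelow _) n

/-- An infimum of continuous functions is upper semicontinuous, and a monotone upper semicontinuous
function is right continuous. -/
theorem isGauge_rampGauge (a K : ℕ → ℝ≥0) : IsGauge (rampGauge a K) := by
  have hmono : Monotone (rampGauge a K) := fun x y h =>
    le_ciInf fun n => (rampGauge_le a K x n).trans (by gcongr)
  refine ⟨hmono, fun x => tendsto_order.2 ⟨fun b hb => ?_, fun b hb => ?_⟩⟩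
  · filter_upwards [self_mem_nhdsWithin] with y hy
    exact hb.trans_le (hmono hy)
  · obtain ⟨n, hn⟩ := exists_lt_of_ciInf_lt hb
    have hc : Continuous fun y : ℝ≥0 => max (a n) (K n * y) := by fun_prop
    filter_upwards [mem_nhdsWithin_of_mem_nhds (hc.continuousAt.eventually_lt_const hn)] with y hy
    exact (rampGauge_le a K y n).trans_lt hy

theorem rampGauge_zero {a : ℕ → ℝ≥0} (ha : Tendsto a atTop (𝓝 0)) (K : ℕ → ℝ≥0) :
    rampGauge a K 0 = 0 := by
  refine le_antisymm (ge_of_tendsto' ha fun n => ?_) zero_le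
  simpa using rampGauge_le a K 0 n

/-! ### Interval families and their refinement -/

/-- A finite family of closed intervals of a common length, whose left end points are at distance
at least twice that length from each other. -/
structure IntervalFamily where
  left : Finset ℝ
  len : ℝ
  len_pos : 0 < len
  nonempty : left.Nonempty
  sep : ∀ x ∈ left, ∀ y ∈ left, x ≠ y → 2 * len ≤ |x - y|

namespace IntervalFamily

/-- The union of the intervals of the family. -/
def carrier (Z : IntervalFamily) : Set ℝ := ⋃ x ∈ Z.left, Icc x (x + Z.len)

/-- The left end points of the intervals of the family that meet `V`. -/
noncomputable def meeting (Z : IntervalFamily) (V : Set ℝ) : Finset ℝ := by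
  classical exact Z.left.filter fun x => (Icc x (x + Z.len) ∩ V).Nonempty

/-- The inverse of the total length of the family. -/
noncomputable def density (Z : IntervalFamily) : ℝ := (Z.left.card * Z.len)⁻¹

theorem card_pos (Z : IntervalFamily) : (0 : ℝ) < Z.left.card := by
  exact_mod_cast Z.nonempty.card_pos

theorem density_pos (Z : IntervalFamily) : 0 < Z.density :=
  inv_pos.2 (mul_pos Z.card_pos Z.len_pos)

theorem mem_meeting {Z : IntervalFamily} {V : Set ℝ} {x : ℝ} :
    x ∈ Z.meeting V ↔ x ∈ Z.left ∧ (Icc x (x + Z.len) ∩ V).Nonempty := by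
  classical simp [meeting]

theorem isCompact_carrier (Z : IntervalFamily) : IsCompact Z.carrier :=
  Z.left.isCompact_biUnion fun _ _ => isCompact_Icc

/-- `Refines Z Z' N U`: the family `Z'` is obtained by choosing `N` well separated intervals inside
`U` in each interval of `Z`. -/
structure Refines (Z Z' : IntervalFamily) (N : ℕ) (U : Set ℝ) : Prop where
  parent : ∀ y ∈ Z'.left, ∃ x ∈ Z.left, x ≤ y ∧ y + Z'.len ≤ x + Z.len
  card_eq : Z'.left.card = N * Z.left.card
  meeting_le : ∀ V, (Z'.meeting V).card ≤ N * (Z.meeting V).card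
  sep : ∀ x ∈ Z'.left, ∀ y ∈ Z'.left, x ≠ y → Z.len / (2 * N) ≤ |x - y|
  len_le : 4 * N * Z'.len ≤ Z.len
  subset : ∀ y ∈ Z'.left, Icc y (y + Z'.len) ⊆ U

theorem Refines.carrier_subset {Z Z' : IntervalFamily} {N : ℕ} {U : Set ℝ}
    (h : Refines Z Z' N U) : Z'.carrier ⊆ Z.carrier := by
  intro z hz
  simp only [carrier, mem_iUnion, mem_Icc] at hz ⊢
  obtain ⟨y, hy, h1, h2⟩ := hz
  obtain ⟨x, hx, h3, h4⟩ := h.parent y hy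
  exact ⟨x, hx, by linarith, by linarith⟩

theorem Refines.carrier_subset' {Z Z' : IntervalFamily} {N : ℕ} {U : Set ℝ}
    (h : Refines Z Z' N U) : Z'.carrier ⊆ U :=
  iUnion₂_subset h.subset

/-- Each interval is cut into `2 * N` cells of width `w`. The even-numbered cells each receive a
left end point in `U`; the odd ones serve as gaps. -/
theorem exists_refines (Z : IntervalFamily) {N : ℕ} (hN : 0 < N) {U : Set ℝ} (hU : IsOpen U)
    (hd : Dense U) : ∃ Z', Refines Z Z' N U := by
  classical
  have hN' : (0 : ℝ) < N := by exact_mod_cast hN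
  set w : ℝ := Z.len / (2 * N) with hw
  have hw0 : 0 < w := div_pos Z.len_pos (by positivity)
  have hwN : 2 * N * w = Z.len := by rw [hw]; field_simp
  have key : ∀ (x : ℝ) (i : ℕ), ∃ y ρ : ℝ, x + 2 * i * w < y ∧ y < x + (2 * i + 1) * w ∧ 0 < ρ ∧
      Icc y (y + ρ) ⊆ U := by
    intro x i
    obtain ⟨y, hyU, hy⟩ := hd.exists_mem_open (isOpen_Ioo (a := x + 2 * i * w)
      (b := x + (2 * i + 1) * w)) (nonempty_Ioo.2 (by linarith))
    obtain ⟨ε, hε, hb⟩ := Metric.isOpen_iff.1 hU y hyU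
    refine ⟨y, ε / 2, hy.1, hy.2, by positivity, fun z hz => hb ?_⟩
    rw [Metric.mem_ball, Real.dist_eq, abs_lt]
    constructor <;> linarith [hz.1, hz.2]
  choose y ρ hy1 hy2 hρ hyU using key
  obtain ⟨r, hr0, hrw, hr⟩ : ∃ r : ℝ, 0 < r ∧ 2 * r ≤ w ∧
      ∀ x ∈ Z.left, ∀ i < N, r ≤ ρ x i := by
    obtain ⟨x₀, hx₀⟩ := Z.nonempty
    have hne : (Z.left ×ˢ Finset.range N).Nonempty :=
      ⟨(x₀, 0), by simp [hx₀, hN]⟩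
    -- Only finitely many points were chosen, so one length suits them all; `w / 2` keeps the new
    -- intervals short compared with the gaps.
    refine ⟨min (w / 2) ((Z.left ×ˢ Finset.range N).inf' hne fun p => ρ p.1 p.2), ?_, ?_, ?_⟩
    · refine lt_min (by positivity) ((Finset.lt_inf'_iff _).2 fun p _ => hρ _ _)
    · linarith [min_le_left (w / 2) ((Z.left ×ˢ Finset.range N).inf' hne fun p => ρ p.1 p.2)]
    · intro x hx i hi
      exact (min_le_right _ _).trans
        (Finset.inf'_le (fun p : ℝ × ℕ => ρ p.1 p.2) (b := (x, i)) (by simp [hx, hi]))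
  have hwZ : w ≤ Z.len := by
    have : (1 : ℝ) ≤ N := by exact_mod_cast hN
    nlinarith
  have hin : ∀ x, ∀ i < N, x ≤ y x i ∧ y x i + r ≤ x + Z.len := by
    intro x i hi
    have h1 : (i : ℝ) + 1 ≤ N := by exact_mod_cast hi
    have h0 : (0 : ℝ) ≤ i * w := by positivity
    have h2 : ((i : ℝ) + 1) * w ≤ N * w := by gcongr
    constructor
    · linarith [hy1 x i]
    · linarith [hy2 x i]
  have hlt : ∀ x (i j : ℕ), i < j → w ≤ |y x i - y x j| := by
    intro x i j hij
    have h1 : (i : ℝ) + 1 ≤ j := by exact_mod_cast hij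
    have h2 : ((i : ℝ) + 1) * w ≤ j * w := by gcongr
    rw [abs_sub_comm]
    exact le_trans (by linarith [hy2 x i, hy1 x j]) (le_abs_self _)
  have hsep : ∀ x ∈ Z.left, ∀ i < N, ∀ x' ∈ Z.left, ∀ i' < N, (x, i) ≠ (x', i') →
      w ≤ |y x i - y x' i'| := by
    intro x hx i hi x' hx' i' hi' hne
    by_cases hxx : x = x'
    · subst hxx
      rcases lt_trichotomy i i' with h | h | h
      · exact hlt x i i' h
      · exact absurd (by rw [h]) hne
      · rw [abs_sub_comm]; exact hlt x i' i h
    · have h1 := Z.sep x hx x' hx' hxx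
      have h2 := hin x i hi
      have h3 := hin x' i' hi'
      rcases le_abs'.1 h1 with h | h
      · rw [abs_sub_comm]
        exact le_trans (by linarith) (le_abs_self _)
      · exact le_trans (by linarith) (le_abs_self _)
  have hmem : ∀ z, z ∈ (Z.left ×ˢ Finset.range N).image (fun p => y p.1 p.2) ↔
      ∃ x ∈ Z.left, ∃ i < N, y x i = z := by
    intro z; simp [and_assoc]
  have hsep' : ∀ z ∈ (Z.left ×ˢ Finset.range N).image (fun p => y p.1 p.2),
      ∀ z' ∈ (Z.left ×ˢ Finset.range N).image (fun p => y p.1 p.2), z ≠ z' → w ≤ |z - z'| := by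
    intro z hz z' hz' hne
    obtain ⟨x, hx, i, hi, rfl⟩ := (hmem z).1 hz
    obtain ⟨x', hx', i', hi', rfl⟩ := (hmem z').1 hz'
    refine hsep x hx i hi x' hx' i' hi' fun h => hne ?_
    rw [Prod.mk.injEq] at h
    rw [h.1, h.2]
  refine ⟨⟨(Z.left ×ˢ Finset.range N).image fun p => y p.1 p.2, r, hr0, ?_, ?_⟩, ?_, ?_, ?_, ?_,
    ?_, ?_⟩
  · exact (Z.nonempty.product ⟨0, by simp [hN]⟩).image _
  · exact fun z hz z' hz' hne => hrw.trans (hsep' z hz z' hz' hne)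
  · intro z hz
    obtain ⟨x, hx, i, hi, rfl⟩ := (hmem z).1 hz
    exact ⟨x, hx, hin x i hi⟩
  · dsimp only
    rw [Finset.card_image_of_injOn, Finset.card_product, Finset.card_range, mul_comm]
    rintro ⟨x, i⟩ hp ⟨x', i'⟩ hp' heq
    simp only [Finset.coe_product, mem_prod, Finset.mem_coe, Finset.mem_range] at hp hp'
    by_contra hne
    have := hsep x hp.1 i hp.2 x' hp'.1 i' hp'.2 hne
    dsimp only at heq
    rw [heq, sub_self, abs_zero] at this
    linarith
  · intro V
    -- A child that meets `V` has a parent that meets `V`.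
    have : meeting ⟨(Z.left ×ˢ Finset.range N).image fun p => y p.1 p.2, r, hr0,
        (Z.nonempty.product ⟨0, by simp [hN]⟩).image _,
        fun z hz z' hz' hne => hrw.trans (hsep' z hz z' hz' hne)⟩ V ⊆
        (Z.meeting V ×ˢ Finset.range N).image fun p => y p.1 p.2 := by
      intro z hz
      obtain ⟨hz1, v, hv, hvV⟩ := mem_meeting.1 hz
      obtain ⟨x, hx, i, hi, rfl⟩ := (hmem z).1 hz1
      have h := hin x i hi
      simp only [Finset.mem_image, Finset.mem_product, Finset.mem_range, Prod.exists]
      exact ⟨x, i, ⟨mem_meeting.2 ⟨hx, v, ⟨h.1.trans hv.1, hv.2.trans h.2⟩, hvV⟩, hi⟩, rfl⟩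
    refine (Finset.card_le_card this).trans (Finset.card_image_le.trans ?_)
    rw [Finset.card_product, Finset.card_range, mul_comm]
  · exact hsep'
  · show 4 * N * r ≤ Z.len
    nlinarith
  · intro z hz
    obtain ⟨x, hx, i, hi, rfl⟩ := (hmem z).1 hz
    exact (Icc_subset_Icc_right (by linarith [hr x hx i hi])).trans (hyU x i)

end IntervalFamily

/-! ### Counting the intervals that meet a set -/

/-- A finite set of reals that is `σ`-separated and has diameter at most `L` has at most
`1 + L / σ` elements. -/
theorem card_le_of_separated {T : Finset ℝ} {σ L : ℝ} (hσ : 0 < σ) (hL : 0 ≤ L)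
    (hsep : ∀ x ∈ T, ∀ y ∈ T, x ≠ y → σ ≤ |x - y|) (hdiam : ∀ x ∈ T, ∀ y ∈ T, |x - y| ≤ L) :
    (T.card : ℝ) ≤ 1 + L / σ := by
  rcases T.eq_empty_or_nonempty with rfl | hT
  · simp; positivity
  set m := T.min' hT with hm
  have hge : ∀ x ∈ T, 0 ≤ (x - m) / σ := fun x hx =>
    div_nonneg (sub_nonneg.2 (T.min'_le x hx)) hσ.le
  -- Two points with the same rounded position, in units of `σ`, would be less than `σ` apart.
  have hinj : Set.InjOn (fun x => ⌊(x - m) / σ⌋₊) T := by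
    intro x hx y hy hxy
    by_contra hne
    have h1 := hsep x hx y hy hne
    dsimp only at hxy
    have hx1 := Nat.floor_le (hge x hx)
    have hx2 := Nat.lt_floor_add_one ((x - m) / σ)
    have hy1 := Nat.floor_le (hge y hy)
    have hy2 := Nat.lt_floor_add_one ((y - m) / σ)
    rw [hxy] at hx1 hx2
    have h2 : |(x - m) / σ - (y - m) / σ| < 1 := by
      rw [abs_lt]; constructor <;> linarith
    rw [← sub_div, sub_sub_sub_cancel_right, abs_div, abs_of_pos hσ, div_lt_one hσ] at h2
    linarith
  have hmaps : ∀ x ∈ T, ⌊(x - m) / σ⌋₊ ∈ Finset.range (⌊L / σ⌋₊ + 1) := by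
    intro x hx
    rw [Finset.mem_range, Nat.lt_succ_iff]
    refine Nat.floor_le_floor ?_
    gcongr
    exact (le_abs_self _).trans (hdiam x hx m (T.min'_mem hT))
  have h := Finset.card_le_card_of_injOn _ hmaps hinj
  rw [Finset.card_range] at h
  have h' : (T.card : ℝ) ≤ ⌊L / σ⌋₊ + 1 := by exact_mod_cast h
  linarith [Nat.floor_le (div_nonneg hL hσ.le)]

namespace IntervalFamily

theorem card_mul_density (Z : IntervalFamily) : Z.left.card * Z.density = Z.len⁻¹ := by
  have h1 := Z.card_pos.ne'
  have h2 := Z.len_pos.ne'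
  rw [density]; field_simp

theorem card_meeting_le (Z : IntervalFamily) {V : Set ℝ} {d σ : ℝ} (hd : 0 ≤ d) (hσ : 0 < σ)
    (hV : ∀ x ∈ V, ∀ y ∈ V, |x - y| ≤ d)
    (hsep : ∀ x ∈ Z.left, ∀ y ∈ Z.left, x ≠ y → σ ≤ |x - y|) :
    ((Z.meeting V).card : ℝ) ≤ 1 + (d + Z.len) / σ := by
  refine card_le_of_separated hσ (add_nonneg hd Z.len_pos.le)
    (fun x hx y hy => hsep x (mem_meeting.1 hx).1 y (mem_meeting.1 hy).1) fun x hx y hy => ?_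
  obtain ⟨-, u, hu, huV⟩ := mem_meeting.1 hx
  obtain ⟨-, v, hv, hvV⟩ := mem_meeting.1 hy
  have h := abs_le.1 (hV u huV v hvV)
  rw [abs_le]
  constructor <;> linarith [hu.1, hu.2, hv.1, hv.2]

theorem Refines.card_eq_real {Z Z' : IntervalFamily} {N : ℕ} {U : Set ℝ} (h : Refines Z Z' N U) :
    (Z'.left.card : ℝ) = N * Z.left.card := by exact_mod_cast h.card_eq

theorem Refines.pos {Z Z' : IntervalFamily} {N : ℕ} {U : Set ℝ} (h : Refines Z Z' N U) :
    (0 : ℝ) < N := by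
  have h1 := h.card_eq_real ▸ Z'.card_pos
  exact pos_of_mul_pos_left h1 Z.card_pos.le

theorem Refines.card_mul_density {Z Z' : IntervalFamily} {N : ℕ} {U : Set ℝ}
    (h : Refines Z Z' N U) : Z'.left.card * Z.density = N / Z.len := by
  rw [h.card_eq_real, mul_assoc, Z.card_mul_density, div_eq_mul_inv]

/-- After multiplication by the number of children this is `N * Z'.len ≤ Z.len`. At the scale of the
children the ramp of slope `Z.density` is thus on its flat part. -/
theorem Refines.density_mul_len_le {Z Z' : IntervalFamily} {N : ℕ} {U : Set ℝ}
    (h : Refines Z Z' N U) : Z.density * Z'.len ≤ (Z'.left.card : ℝ)⁻¹ := by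
  rw [le_inv_comm₀ (mul_pos Z.density_pos Z'.len_pos) Z'.card_pos,
    le_inv_comm₀ Z'.card_pos (mul_pos Z.density_pos Z'.len_pos),
    ← one_div, le_div_iff₀ Z'.card_pos]
  have : Z.density * Z'.len * Z'.left.card = N * Z'.len / Z.len := by
    linear_combination Z'.len * h.card_mul_density
  rw [this, div_le_one Z.len_pos]
  nlinarith [h.len_le, h.pos, Z'.len_pos, mul_pos h.pos Z'.len_pos]

theorem Refines.density_le {Z Z' : IntervalFamily} {N : ℕ} {U : Set ℝ}
    (h : Refines Z Z' N U) : Z.density ≤ Z'.density := by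
  have h1 := h.density_mul_len_le
  rw [← le_div_iff₀ Z'.len_pos] at h1
  rwa [density.eq_1 Z', mul_inv, ← div_eq_mul_inv]

/-! ### The gauge and the limit set of a scheme -/

/-- The gauge function adapted to a sequence of successively refined families. -/
noncomputable def gauge (Z : ℕ → IntervalFamily) : ℝ≥0 → ℝ≥0 :=
  rampGauge (fun n => ((Z (n + 1)).left.card : ℝ≥0)⁻¹) fun n => (Z n).density.toNNReal

/-- The set of points that lie in an interval of each of the families. -/
def limitSet (Z : ℕ → IntervalFamily) : Set ℝ := ⋂ n, (Z n).carrier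

section Scheme

variable {Z : ℕ → IntervalFamily} {N : ℕ → ℕ} {U : ℕ → Set ℝ}

theorem isGauge_gauge (Z : ℕ → IntervalFamily) : IsGauge (gauge Z) := isGauge_rampGauge _ _

theorem isCompact_limitSet (Z : ℕ → IntervalFamily) : IsCompact (limitSet Z) :=
  (Z 0).isCompact_carrier.of_isClosed_subset
    (isClosed_iInter fun n => (Z n).isCompact_carrier.isClosed) (iInter_subset _ 0)

theorem antitone_carrier (h : ∀ n, Refines (Z n) (Z (n + 1)) (N n) (U n)) :
    Antitone fun n => (Z n).carrier :=
  antitone_nat_of_succ_le fun n => (h n).carrier_subset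

theorem monotone_density (h : ∀ n, Refines (Z n) (Z (n + 1)) (N n) (U n)) :
    Monotone fun n => (Z n).density :=
  monotone_nat_of_le_succ fun n => (h n).density_le

theorem limitSet_subset (h : ∀ n, Refines (Z n) (Z (n + 1)) (N n) (U n)) :
    limitSet Z ⊆ ⋂ n, U n :=
  subset_iInter fun n => (iInter_subset _ (n + 1)).trans (h n).carrier_subset'

theorem two_pow_le_card (h : ∀ n, Refines (Z n) (Z (n + 1)) (N n) (U n)) (hN : ∀ n, 2 ≤ N n)
    (n : ℕ) : 2 ^ n ≤ (Z n).left.card := by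
  induction n with
  | zero => simpa using (Z 0).nonempty.card_pos
  | succ n ih =>
    rw [(h n).card_eq, pow_succ, mul_comm]
    exact Nat.mul_le_mul (hN n) ih

theorem len_le_pow (h : ∀ n, Refines (Z n) (Z (n + 1)) (N n) (U n)) (n : ℕ) :
    (Z n).len ≤ (Z 0).len * (1 / 2) ^ n := by
  induction n with
  | zero => simp
  | succ n ih =>
    have h1 : (1 : ℝ) ≤ N n := by exact_mod_cast (h n).pos
    have h2 := (h n).len_le
    have h3 := mul_le_mul_of_nonneg_right h1 (Z (n + 1)).len_pos.le
    rw [pow_succ]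
    linarith [(Z (n + 1)).len_pos]

theorem tendsto_len (h : ∀ n, Refines (Z n) (Z (n + 1)) (N n) (U n)) :
    Tendsto (fun n => (Z n).len) atTop (𝓝 0) := by
  refine squeeze_zero (fun n => (Z n).len_pos.le) (len_le_pow h) ?_
  simpa using (tendsto_pow_atTop_nhds_zero_of_lt_one (by norm_num : (0 : ℝ) ≤ 1 / 2)
    (by norm_num)).const_mul (Z 0).len

theorem gauge_zero (h : ∀ n, Refines (Z n) (Z (n + 1)) (N n) (U n)) (hN : ∀ n, 2 ≤ N n) :
    gauge Z 0 = 0 := by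
  refine rampGauge_zero ?_ _
  have h1 : Tendsto (fun n => (Z (n + 1)).left.card) atTop atTop :=
    tendsto_atTop_mono (fun n => (Nat.lt_two_pow_self.le.trans
      (two_pow_le_card h hN n)).trans (by
        rw [(h n).card_eq]; exact Nat.le_mul_of_pos_left _ (by linarith [hN n]))) tendsto_id
  exact tendsto_inv_atTop_zero.comp (tendsto_natCast_atTop_atTop.comp h1)

/-- On the range of scales from `(Z n).len / N n` on, the gauge is at most linear. -/
theorem gauge_le_density_mul (h : ∀ n, Refines (Z n) (Z (n + 1)) (N n) (U n)) (n : ℕ) {x : ℝ≥0}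
    (hx : (Z n).len / N n ≤ x) : (gauge Z x : ℝ) ≤ (Z n).density * x := by
  have h1 : (gauge Z x : ℝ) ≤ max ((Z (n + 1)).left.card : ℝ)⁻¹ ((Z n).density * x) := by
    have := NNReal.coe_le_coe.2 (rampGauge_le _ _ x n :
      gauge Z x ≤ max ((Z (n + 1)).left.card : ℝ≥0)⁻¹ ((Z n).density.toNNReal * x))
    rw [NNReal.coe_max, NNReal.coe_mul, Real.coe_toNNReal _ (Z n).density_pos.le] at this
    exact_mod_cast this
  refine h1.trans (max_le ?_ le_rfl)
  rw [inv_le_iff_one_le_mul₀ (Z (n + 1)).card_pos]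
  have h2 : (Z n).density * x * (Z (n + 1)).left.card = x * (N n / (Z n).len) := by
    linear_combination (x : ℝ) * (h n).card_mul_density
  rw [h2, mul_div_assoc', one_le_div (Z n).len_pos]
  rwa [div_le_iff₀ (h n).pos] at hx

theorem gauge_len_le (h : ∀ n, Refines (Z n) (Z (n + 1)) (N n) (U n)) (n : ℕ) :
    gauge Z (Z (n + 1)).len.toNNReal ≤ ((Z (n + 1)).left.card : ℝ≥0)⁻¹ := by
  refine (rampGauge_le _ _ _ n).trans (max_le le_rfl ?_)
  rw [← Real.toNNReal_mul (Z n).density_pos.le]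
  refine Real.toNNReal_le_iff_le_coe.2 ?_
  simpa using (h n).density_mul_len_le

/-- The proportion of intervals that meet `V` cannot grow under refinement. -/
theorem card_meeting_le_card_mul (h : ∀ n, Refines (Z n) (Z (n + 1)) (N n) (U n)) (V : Set ℝ)
    {m n : ℕ} (hmn : m ≤ n) : ((Z n).meeting V).card * (Z m).left.card ≤
      (Z n).left.card * ((Z m).meeting V).card := by
  induction n, hmn using Nat.le_induction with
  | base => rw [mul_comm]
  | succ n _ ih =>
    calc _ ≤ N n * ((Z n).meeting V).card * (Z m).left.card := by
          gcongr; exact (h n).meeting_le V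
      _ ≤ N n * ((Z n).left.card * ((Z m).meeting V).card) := by
          rw [mul_assoc]; gcongr
      _ = _ := by rw [(h n).card_eq, mul_assoc]

/-- A set of diameter at most `d` meets at most the proportion `4 * gauge Z d` of the intervals of
a family of length at most `d`. -/
theorem card_meeting_le_gauge (h : ∀ n, Refines (Z n) (Z (n + 1)) (N n) (U n)) {V : Set ℝ}
    {d : ℝ≥0} (hV : ∀ x ∈ V, ∀ y ∈ V, |x - y| ≤ d) {n : ℕ} (hn : (Z n).len ≤ d) :
    (((Z n).meeting V).card : ℝ) ≤ 4 * (Z n).left.card * gauge Z d := by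
  have hP := (Z n).card_pos
  have hd : (0 : ℝ) < d := (Z n).len_pos.trans_le hn
  have key : ∀ m, (((Z n).meeting V).card : ℝ) ≤ 4 * (Z n).left.card *
      max ((Z (m + 1)).left.card : ℝ)⁻¹ ((Z m).density * d) := by
    intro m
    rcases le_or_gt (m + 1) n with hm | hm
    -- Count in the coarser family `m + 1`, using its separation. The count is at most `2 + 2 * (N m
    -- * d / (Z m).len)`, and both `1` and `N m * d / (Z m).len` are at most `Q * X`; hence the
    -- constant `4`.
    · have hσ : 0 < (Z m).len / (2 * N m) := div_pos (Z m).len_pos (by linarith [(h m).pos])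
      have h1 := card_meeting_le (Z (m + 1)) hd.le hσ hV (h m).sep
      have h2 : (((Z n).meeting V).card : ℝ) * (Z (m + 1)).left.card ≤
          (Z n).left.card * ((Z (m + 1)).meeting V).card := by
        exact_mod_cast card_meeting_le_card_mul h V hm
      have hQ := (Z (m + 1)).card_pos
      set Q : ℝ := ((Z (m + 1)).left.card : ℝ)
      set X := max Q⁻¹ ((Z m).density * d) with hX
      have h3 : 1 ≤ Q * X := by
        calc (1 : ℝ) = Q * Q⁻¹ := (mul_inv_cancel₀ hQ.ne').symm
          _ ≤ Q * X := by gcongr; exact le_max_left _ _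
      have h4 : N m / (Z m).len * d ≤ Q * X := by
        rw [← (h m).card_mul_density, mul_assoc]
        exact mul_le_mul_of_nonneg_left (le_max_right _ _) hQ.le
      have h5 : (d + (Z (m + 1)).len) / ((Z m).len / (2 * N m)) ≤
          2 * (N m / (Z m).len * d) + 1 := by
        have := (h m).len_le
        have hl := (Z m).len_pos
        rw [div_div_eq_mul_div, div_le_iff₀ hl]
        have e : (2 * (N m / (Z m).len * d) + 1) * (Z m).len = 2 * N m * d + (Z m).len := by
          field_simp
        rw [e]
        nlinarith [mul_pos (h m).pos (Z (m + 1)).len_pos]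
      have h6 : (((Z (m + 1)).meeting V).card : ℝ) ≤ 4 * (Q * X) := by linarith
      have h7 := h2.trans (mul_le_mul_of_nonneg_left h6 hP.le)
      refine le_of_mul_le_mul_right (h7.trans (le_of_eq ?_)) hQ
      ring
    -- Here `n ≤ m`: the separation of family `n` itself suffices, since the densities increase.
    · have h1 := card_meeting_le (Z n) hd.le (by linarith [(Z n).len_pos] : 0 < 2 * (Z n).len) hV
        (Z n).sep
      have hl := (Z n).len_pos
      have h2 : (d : ℝ) / (Z n).len ≤ (Z n).left.card *
          max ((Z (m + 1)).left.card : ℝ)⁻¹ ((Z m).density * d) := by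
        calc (d : ℝ) / (Z n).len = (Z n).left.card * ((Z n).density * d) := by
              rw [← mul_assoc, (Z n).card_mul_density, div_eq_mul_inv, mul_comm]
          _ ≤ (Z n).left.card * ((Z m).density * d) := by
              gcongr; exact monotone_density h (Nat.lt_succ_iff.1 hm)
          _ ≤ _ := by gcongr; exact le_max_right _ _
      have h3 : 1 ≤ (d : ℝ) / (Z n).len := (one_le_div hl).2 hn
      have h4 : (d + (Z n).len) / (2 * (Z n).len) = (d / (Z n).len) / 2 + 1 / 2 := by
        field_simp
      linarith
  have h4 : (0 : ℝ) < 4 * (Z n).left.card := by linarith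
  rw [← div_le_iff₀' h4]
  have hnn : 0 ≤ (((Z n).meeting V).card : ℝ) / (4 * (Z n).left.card) := by positivity
  rw [← Real.coe_toNNReal _ hnn, NNReal.coe_le_coe]
  refine le_ciInf fun m => Real.toNNReal_le_iff_le_coe.2 ?_
  have := (div_le_iff₀' h4).2 (key m)
  simpa [Real.coe_toNNReal _ (Z m).density_pos.le] using this

/-! ### The limit set has positive finite measure -/

theorem gaugeHausdorff_limitSet_le (h : ∀ n, Refines (Z n) (Z (n + 1)) (N n) (U n)) :
    gaugeHausdorff (gauge Z) (limitSet Z) ≤ 1 := by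
  have hdiam : ∀ n (x : ℝ), Metric.ediam (Icc x (x + (Z n).len)) = ENNReal.ofReal (Z n).len := by
    intro n x; rw [Real.ediam_Icc, add_sub_cancel_left]
  refine (Measure.mkMetric_le_liminf_sum (ι := fun n : ℕ => (Z (n + 1)).left) (limitSet Z)
    (l := atTop) (fun n => ENNReal.ofReal (Z (n + 1)).len) ?_
    (fun n x => Icc (x : ℝ) (x + (Z (n + 1)).len)) ?_ ?_ _).trans ?_
  · simpa using ENNReal.tendsto_ofReal ((tendsto_add_atTop_iff_nat 1).2 (tendsto_len h))
  · exact Eventually.of_forall fun n x => (hdiam _ _).le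
  · refine Eventually.of_forall fun n => (iInter_subset _ (n + 1)).trans ?_
    intro z hz
    simp only [carrier, mem_iUnion] at hz ⊢
    obtain ⟨x, hx, hz⟩ := hz
    exact ⟨⟨x, hx⟩, hz⟩
  · refine (liminf_le_liminf (v := fun _ => (1 : ℝ≥0∞)) (Eventually.of_forall fun n => ?_)).trans
      (by simp)
    simp only [hdiam]
    rw [Finset.sum_const, Finset.card_univ, Fintype.card_coe, nsmul_eq_mul]
    have hc : ((Z (n + 1)).left.card : ℝ≥0) ≠ 0 := by
      exact_mod_cast (Z (n + 1)).nonempty.card_pos.ne'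
    calc ((Z (n + 1)).left.card : ℝ≥0∞) * (gauge Z (Z (n + 1)).len.toNNReal : ℝ≥0∞)
        ≤ ((Z (n + 1)).left.card : ℝ≥0∞) * (((Z (n + 1)).left.card : ℝ≥0)⁻¹ : ℝ≥0) := by
          gcongr; exact gauge_len_le h n
      _ = (((Z (n + 1)).left.card : ℝ≥0) * ((Z (n + 1)).left.card : ℝ≥0)⁻¹ : ℝ≥0) := by
          push_cast; rfl
      _ = 1 := by rw [mul_inv_cancel₀ hc]; rfl

/-- Finitely many open sets that cover the limit set have gauges summing up to at least `1 / 4`. -/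
theorem one_le_sum_gauge (h : ∀ n, Refines (Z n) (Z (n + 1)) (N n) (U n)) {V : ℕ → Set ℝ}
    {d : ℕ → ℝ≥0} (hd : ∀ i, 0 < d i) (hV : ∀ i, ∀ x ∈ V i, ∀ y ∈ V i, |x - y| ≤ d i)
    (hVo : ∀ i, IsOpen (V i)) (t : Finset ℕ) (ht : limitSet Z ⊆ ⋃ i ∈ t, V i) :
    1 ≤ 4 * ∑ i ∈ t, (gauge Z (d i) : ℝ) := by
  classical
  have hopen : IsOpen (⋃ i ∈ t, V i) := isOpen_biUnion fun i _ => hVo i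
  -- By compactness the cover already contains a whole carrier, so every interval of a late family
  -- meets some `V i` and the proportions add up to at least `1`.
  obtain ⟨n₀, hn₀⟩ := exists_subset_nhds_of_isCompact
    (V := fun n => (Z n).carrier) (antitone_carrier h).directed_ge
    (fun n => (Z n).isCompact_carrier) (fun x hx => hopen.mem_nhds (ht hx))
  have hev : ∀ᶠ n in atTop, ∀ i ∈ t, (Z n).len ≤ d i :=
    (Filter.eventually_all_finset t).2 fun i _ =>
      ((tendsto_len h).eventually_lt_const (NNReal.coe_pos.2 (hd i))).mono fun _ => le_of_lt
  obtain ⟨n, hnd, hn⟩ := (hev.and (eventually_ge_atTop n₀)).exists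
  have hcov : (Z n).left ⊆ t.biUnion fun i => (Z n).meeting (V i) := by
    intro x hx
    have hxc : x ∈ (Z n).carrier := mem_biUnion hx ⟨le_rfl, by linarith [(Z n).len_pos]⟩
    obtain ⟨i, hi, hxi⟩ := mem_iUnion₂.1 (hn₀ (antitone_carrier h hn hxc))
    exact Finset.mem_biUnion.2 ⟨i, hi, mem_meeting.2 ⟨hx, x,
      ⟨le_rfl, by linarith [(Z n).len_pos]⟩, hxi⟩⟩
  have h1 : ((Z n).left.card : ℝ) ≤ ∑ i ∈ t, (((Z n).meeting (V i)).card : ℝ) := by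
    exact_mod_cast (Finset.card_le_card hcov).trans Finset.card_biUnion_le
  have h2 : ((Z n).left.card : ℝ) ≤ ∑ i ∈ t, 4 * (Z n).left.card * (gauge Z (d i) : ℝ) :=
    h1.trans (Finset.sum_le_sum fun i hi => card_meeting_le_gauge h (hV i) (hnd i hi))
  rw [← Finset.mul_sum] at h2
  refine le_of_mul_le_mul_left (a := ((Z n).left.card : ℝ)) ?_ (Z n).card_pos
  linarith

/-- Right continuity allows the members of a cover to be thickened to open sets at small cost;
compactness then reduces the bound to finite open covers. -/
theorem gaugeHausdorff_limitSet_pos (h : ∀ n, Refines (Z n) (Z (n + 1)) (N n) (U n))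
    (hN : ∀ n, 2 ≤ N n) : 0 < gaugeHausdorff (gauge Z) (limitSet Z) := by
  suffices H : (1 : ℝ≥0∞) ≤ 4 * gaugeHausdorff (gauge Z) (limitSet Z) by
    rw [pos_iff_ne_zero]
    intro h0
    simp [h0] at H
  rw [gaugeHausdorff_apply _ (gauge_zero h hN)]
  rw [mul_comm, ← ENNReal.div_le_iff_le_mul (by simp) (by simp)]
  -- The scale `1` serves only to make all diameters finite, so that `toNNReal` loses nothing.
  refine le_iSup₂_of_le (1 : ℝ≥0∞) one_pos ?_
  refine le_iInf fun W => le_iInf fun hW => le_iInf fun hW1 => ?_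
  rw [ENNReal.div_le_iff_le_mul (by simp) (by simp)]
  refine ENNReal.le_of_forall_pos_le_add fun ε hε _ => ?_
  obtain ⟨ε', hε', c, hsum, hc⟩ := NNReal.exists_pos_sum_of_countable
    (div_pos hε (by norm_num : (0 : ℝ≥0) < 4)).ne' ℕ
  have hη : ∀ i, ∃ η : ℝ≥0, 0 < η ∧ gauge Z ((Metric.ediam (W i)).toNNReal + 2 * η) ≤
      gauge Z (Metric.ediam (W i)).toNNReal + ε' i := by
    intro i
    set D := (Metric.ediam (W i)).toNNReal
    have h1 := ((isGauge_gauge Z).right_cont D).eventually_lt_const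
      (lt_add_of_pos_right (gauge Z D) (hε' i))
    obtain ⟨b, hb, hb'⟩ := (mem_nhdsGE_iff_exists_Ico_subset' (lt_add_one D)).1 h1
    obtain ⟨e, he1, he2⟩ := exists_between (show D < b from hb)
    refine ⟨(e - D) / 2, by simpa using he1, (hb' ?_).le⟩
    rw [mul_div_cancel₀ _ two_ne_zero, add_tsub_cancel_of_le he1.le]
    exact ⟨he1.le, he2⟩
  choose η hη0 hη using hη
  have hfin : ∀ i, Metric.ediam (W i) ≠ ∞ := fun i => ((hW1 i).trans_lt ENNReal.one_lt_top).ne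
  have hdist : ∀ i, ∀ x ∈ Metric.thickening (η i) (W i), ∀ y ∈ Metric.thickening (η i) (W i),
      |x - y| ≤ ((Metric.ediam (W i)).toNNReal + 2 * η i : ℝ≥0) := by
    intro i x hx y hy
    obtain ⟨x', hx', hxx⟩ := Metric.mem_thickening_iff.1 hx
    obtain ⟨y', hy', hyy⟩ := Metric.mem_thickening_iff.1 hy
    have h1 : dist x' y' ≤ (Metric.ediam (W i)).toNNReal := by
      have := Metric.edist_le_ediam_of_mem hx' hy'
      rw [← ENNReal.coe_toNNReal (hfin i), edist_nndist, ENNReal.coe_le_coe] at this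
      exact_mod_cast this
    have h2 := dist_triangle4 x x' y' y
    rw [dist_comm y' y] at h2
    rw [← Real.dist_eq]
    push_cast at h1 ⊢
    linarith
  have hcov : limitSet Z ⊆ ⋃ i, Metric.thickening (η i) (W i) :=
    hW.trans (iUnion_mono fun i => Metric.self_subset_thickening (hη0 i) _)
  obtain ⟨t, ht⟩ := (isCompact_limitSet Z).elim_finite_subcover _
    (fun i => Metric.isOpen_thickening) hcov
  have h1 := one_le_sum_gauge h (d := fun i => (Metric.ediam (W i)).toNNReal + 2 * η i)
    (fun i => by have := hη0 i; positivity) hdist (fun i => Metric.isOpen_thickening) t ht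
  have h2 : (1 : ℝ≥0) ≤ 4 * ∑ i ∈ t, gauge Z ((Metric.ediam (W i)).toNNReal + 2 * η i) := by
    exact_mod_cast h1
  have h3 : (1 : ℝ≥0∞) ≤ 4 * ∑ i ∈ t,
      (gauge Z ((Metric.ediam (W i)).toNNReal + 2 * η i) : ℝ≥0∞) := by exact_mod_cast h2
  have h4 : ∑ i ∈ t, (gauge Z ((Metric.ediam (W i)).toNNReal + 2 * η i) : ℝ≥0∞) ≤
      (∑' i, (gauge Z (Metric.ediam (W i)).toNNReal : ℝ≥0∞)) + ∑' i, (ε' i : ℝ≥0∞) := by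
    rw [← ENNReal.tsum_add]
    exact (Finset.sum_le_sum fun i _ => by exact_mod_cast hη i).trans
      (ENNReal.sum_le_tsum t)
  have h5 : ∑' i, (ε' i : ℝ≥0∞) ≤ (ε / 4 : ℝ≥0) := by
    rw [← ENNReal.coe_tsum hsum.summable, hsum.tsum_eq]
    exact_mod_cast hc.le
  have h6 : (4 : ℝ≥0∞) * (ε / 4 : ℝ≥0) = ε := by
    rw [show (4 : ℝ≥0∞) = ((4 : ℝ≥0) : ℝ≥0∞) by norm_num, ← ENNReal.coe_mul,
      mul_div_cancel₀ _ (by norm_num)]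
  calc (1 : ℝ≥0∞) ≤ 4 * ((∑' i, (gauge Z (Metric.ediam (W i)).toNNReal : ℝ≥0∞)) +
        (ε / 4 : ℝ≥0)) := h3.trans (by gcongr; exact h4.trans (by gcongr))
    _ = _ := by rw [mul_add, h6, mul_comm]

end Scheme

end IntervalFamily

/-! ### Interleaving two schemes -/

theorem exists_seq_of_step {α : Type*} {P : ℕ → α → Prop} {R : ℕ → α → α → Prop} {a : α}
    (h0 : P 0 a) (hstep : ∀ n x, P n x → ∃ y, P (n + 1) y ∧ R n x y) :
    ∃ f : ℕ → α, f 0 = a ∧ ∀ n, P n (f n) ∧ R n (f n) (f (n + 1)) := by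
  choose F hF hR using hstep
  let f : ∀ n, {x // P n x} := fun n =>
    Nat.rec ⟨a, h0⟩ (fun n x => ⟨F n x.1 x.2, hF n x.1 x.2⟩) n
  exact ⟨fun n => (f n).1, rfl, fun n => ⟨(f n).2, hR n (f n).1 (f n).2⟩⟩

theorem exists_lt_mul_tsum_tail_le (ℓ : ℕ → ℝ≥0) (K : ℝ) {ε : ℝ} (hε : 0 < ε) (t : ℕ) :
    ∃ t', t < t' ∧ K * ∑' k, (ℓ (k + t') : ℝ) ≤ ε := by
  have h : Tendsto (fun n => K * ∑' k, (ℓ (k + n) : ℝ)) atTop (𝓝 0) := by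
    simpa using (tendsto_sum_nat_add fun k => (ℓ k : ℝ)).const_mul K
  obtain ⟨t', h1, h2⟩ := ((h.eventually_lt_const hε).and (eventually_gt_atTop t)).exists
  exact ⟨t', h2, h1.le⟩

namespace IntervalFamily

/-- Two alternately refined sequences of families, whose linear ranges of scales take turns in
exhausting a given summable sequence of scales. -/
theorem exists_interleaved {ℓ : ℕ → ℝ≥0} (hℓ : ∀ k, 0 < ℓ k) {U : ℕ → Set ℝ}
    (hU : ∀ n, IsOpen (U n)) (hd : ∀ n, Dense (U n)) (A B : IntervalFamily) :
    ∃ (Z : ℕ → IntervalFamily) (N t : ℕ → ℕ), Z 0 = A ∧ Z 1 = B ∧ (∀ n, 2 ≤ N n) ∧ StrictMono t ∧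
      (∀ n, Refines (Z n) (Z (n + 2)) (N n) (U (n / 2))) ∧
      (∀ n, (Z n).density * ∑' k, (ℓ (k + t n) : ℝ) ≤ (1 / 2) ^ n) ∧
      ∀ n k, t n ≤ k → k < t (n + 1) → (Z n).len / N n ≤ ℓ k := by
  obtain ⟨t₀, -, ht₀⟩ := exists_lt_mul_tsum_tail_le ℓ A.density one_pos 0
  obtain ⟨f, hf0, hf⟩ := exists_seq_of_step
    (P := fun n (s : IntervalFamily × IntervalFamily × ℕ) =>
      s.1.density * ∑' k, (ℓ (k + s.2.2) : ℝ) ≤ (1 / 2) ^ n)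
    (R := fun n s s' => s'.1 = s.2.1 ∧ s.2.2 < s'.2.2 ∧ ∃ N : ℕ, 2 ≤ N ∧
      Refines s.1 s'.2.1 N (U (n / 2)) ∧
      ∀ k, s.2.2 ≤ k → k < s'.2.2 → s.1.len / N ≤ ℓ k)
    (a := (A, B, t₀)) (by simpa using ht₀) (by
      rintro n ⟨X, Y, t⟩ -
      -- The order of choices matters: `t'` depends on the density of `Y`, already fixed; then `N`
      -- is taken so large that the linear range of `X` reaches below every `ℓ k` with `k < t'`.
      obtain ⟨t', htt', ht'⟩ := exists_lt_mul_tsum_tail_le ℓ Y.density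
        (by positivity : (0 : ℝ) < (1 / 2) ^ (n + 1)) t
      have hN : ∀ᶠ N : ℕ in atTop, ∀ k ∈ Finset.range t', X.len / N ≤ ℓ k :=
        (Filter.eventually_all_finset _).2 fun k _ =>
          ((tendsto_const_div_atTop_nhds_zero_nat X.len).eventually_lt_const
            (NNReal.coe_pos.2 (hℓ k))).mono fun _ => le_of_lt
      obtain ⟨N, hN1, hN2⟩ := (hN.and (eventually_ge_atTop 2)).exists
      obtain ⟨X', hX'⟩ := X.exists_refines (by linarith : 0 < N) (hU (n / 2)) (hd (n / 2))
      exact ⟨(Y, X', t'), ht', rfl, htt', N, hN2, hX', fun k _ hk =>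
        hN1 k (Finset.mem_range.2 hk)⟩)
  choose hP hR1 hR2 N hN2 hN using hf
  refine ⟨fun n => (f n).1, N, fun n => (f n).2.2, by simp [hf0], by simp [hR1, hf0], hN2,
    strictMono_nat_of_lt_succ hR2, fun n => ?_, hP, fun n => (hN n).2⟩
  dsimp only
  rw [hR1 (n + 1)]
  exact (hN n).1

end IntervalFamily

/-! ### Null sets of points covered infinitely often -/

/-- The points that lie in infinitely many blocks of a sequence of sets form a null set if the
gauges of the blocks have a finite sum. -/
theorem gaugeHausdorff_frequently_eq_zero {g : ℝ≥0 → ℝ≥0} (hg : Monotone g) {I : ℕ → Set ℝ}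
    {ℓ : ℕ → ℝ≥0} (hI : ∀ k, Metric.ediam (I k) ≤ ℓ k) (hℓ : Summable ℓ) {b : ℕ → Finset ℕ}
    (hb : ∀ m, ∀ k ∈ b m, m ≤ k) (hsum : ∑' m, ∑ k ∈ b m, (g (ℓ k) : ℝ≥0∞) ≠ ∞) :
    gaugeHausdorff g {x | ∃ᶠ m in atTop, ∃ k ∈ b m, x ∈ I k} = 0 := by
  have hℓ' : ∑' k, (ℓ k : ℝ≥0∞) ≠ ∞ := ENNReal.tsum_coe_ne_top_iff_summable.2 hℓ
  refine le_antisymm ?_ zero_le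
  refine (Measure.mkMetric_le_liminf_tsum (ι := fun n : ℕ => Σ m : ℕ, b (m + n)) _
    (l := atTop) (fun n => ∑' k, (ℓ (k + n) : ℝ≥0∞)) ?_ (fun n p => I p.2) ?_ ?_ _).trans ?_
  · exact ENNReal.tendsto_sum_nat_add _ hℓ'
  · refine Eventually.of_forall fun n p => (hI _).trans ?_
    have h := hb _ _ p.2.2
    have h' : (p.2 : ℕ) = (p.2 - n) + n := by omega
    refine le_trans (le_of_eq ?_) (ENNReal.le_tsum ((p.2 : ℕ) - n))
    rw [← h']
  · refine Eventually.of_forall fun n x hx => ?_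
    obtain ⟨m, hm, k, hk, hx⟩ := frequently_atTop.1 hx n
    obtain ⟨m, rfl⟩ := Nat.exists_eq_add_of_le' hm
    exact mem_iUnion.2 ⟨⟨m, k, hk⟩, hx⟩
  · have hlim := ENNReal.tendsto_sum_nat_add (fun m => ∑ k ∈ b m, (g (ℓ k) : ℝ≥0∞)) hsum
    rw [← hlim.liminf_eq]
    refine liminf_le_liminf (Eventually.of_forall fun n => ?_)
    rw [ENNReal.tsum_sigma']
    refine ENNReal.tsum_le_tsum fun m => ?_
    rw [← Finset.tsum_subtype (b (m + n)) fun k => (g (ℓ k) : ℝ≥0∞)]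
    refine ENNReal.tsum_le_tsum fun k => ?_
    have := ENNReal.toNNReal_mono ENNReal.coe_ne_top (hI k)
    exact_mod_cast hg this

/-! ### Lebesgue measure and null sets -/

theorem gaugeHausdorff_id : gaugeHausdorff id = volume := by
  rw [← hausdorffMeasure_real]
  -- The two integrands differ at `∞`, where `toNNReal` is `0`, but only small diameters count.
  have h : ∀ᶠ d : ℝ≥0∞ in 𝓝 0, ((id d.toNNReal : ℝ≥0) : ℝ≥0∞) = d ^ (1 : ℝ) := by
    filter_upwards [gt_mem_nhds ENNReal.zero_lt_top] with d hd
    simp [ENNReal.coe_toNNReal hd.ne]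
  exact le_antisymm (Measure.mkMetric_mono (h.mono fun _ => le_of_eq))
    (Measure.mkMetric_mono (h.mono fun _ h => h.ge))

theorem isGauge_id : IsGauge id := ⟨monotone_id, fun _ => continuousWithinAt_id⟩

theorem measuredByHausdorff_of_volume_pos {A : Set ℝ} (h : 0 < volume A) :
    MeasuredByHausdorff A :=
  ⟨id, isGauge_id, rfl, by rwa [gaugeHausdorff_id], by rw [gaugeHausdorff_id]; infer_instance⟩

/-- A null set is covered infinitely often by a sequence of sets with summable diameters. -/
theorem exists_frequently_mem_of_volume_eq_zero {B : Set ℝ} (hB : volume B = 0) :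
    ∃ (I : ℕ → Set ℝ) (ℓ : ℕ → ℝ≥0), (∀ k, 0 < ℓ k) ∧ Summable ℓ ∧
      (∀ k, Metric.ediam (I k) ≤ ℓ k) ∧ ∀ x ∈ B, ∃ᶠ k in atTop, x ∈ I k := by
  -- `ε` has two uses: it bounds the total diameter of the `j`-th cover, and it pads the lengths to
  -- make them positive.
  obtain ⟨ε, hε, c, hc, -⟩ := NNReal.exists_pos_sum_of_countable (one_ne_zero (α := ℝ≥0)) ℕ
  have hcov : ∀ j, ∃ W : ℕ → Set ℝ, B ⊆ ⋃ i, W i ∧ (∀ i, Metric.ediam (W i) ≤ 1) ∧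
      ∑' i, Metric.ediam (W i) ≤ ε j := by
    intro j
    rw [← gaugeHausdorff_id, gaugeHausdorff_apply _ rfl] at hB
    simp only [ENNReal.iSup_eq_zero] at hB
    have h1 : _ < (ε j : ℝ≥0∞) := (hB 1 one_pos).trans_lt (ENNReal.coe_pos.2 (hε j))
    simp only [iInf_lt_iff] at h1
    obtain ⟨W, hW, hW1, hs⟩ := h1
    refine ⟨W, hW, hW1, le_trans (le_of_eq (tsum_congr fun i => ?_)) hs.le⟩
    exact (ENNReal.coe_toNNReal ((hW1 i).trans_lt ENNReal.one_lt_top).ne).symm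
  choose W hW hW1 hs using hcov
  have hfin : ∀ j i, Metric.ediam (W j i) ≠ ∞ := fun j i =>
    ((hW1 j i).trans_lt ENNReal.one_lt_top).ne
  refine ⟨fun k => W k.unpair.1 k.unpair.2,
    fun k => (Metric.ediam (W k.unpair.1 k.unpair.2)).toNNReal + ε k,
    fun k => add_pos_of_nonneg_of_pos zero_le (hε k), Summable.add ?_ hc.summable, fun k => ?_,
    fun x hx => ?_⟩
  · rw [← ENNReal.tsum_coe_ne_top_iff_summable]
    simp only [ENNReal.coe_toNNReal (hfin _ _)]
    have h1 : ∑' k : ℕ, Metric.ediam (W k.unpair.1 k.unpair.2) =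
        ∑' p : ℕ × ℕ, Metric.ediam (W p.1 p.2) :=
      Nat.pairEquiv.symm.tsum_eq fun p : ℕ × ℕ => Metric.ediam (W p.1 p.2)
    rw [h1, ENNReal.tsum_prod (f := fun j i => Metric.ediam (W j i))]
    exact ne_top_of_le_ne_top (ENNReal.tsum_coe_ne_top_iff_summable.2 hc.summable)
      (ENNReal.tsum_le_tsum hs)
  · rw [ENNReal.coe_add, ENNReal.coe_toNNReal (hfin _ _)]
    exact le_self_add
  · refine frequently_atTop.2 fun n => ?_
    obtain ⟨i, hi⟩ := mem_iUnion.1 (hW n hx)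
    exact ⟨Nat.pair n i, Nat.left_le_pair n i, by simpa using hi⟩

/-- Without atoms, the restricted measure is not concentrated at one point, so two distinct points
have all neighbourhoods of positive measure; `c` is taken between them. -/
theorem exists_split_of_volume_pos {B : Set ℝ} (h : volume B ≠ 0) :
    ∃ c : ℝ, 0 < volume (B ∩ Iio c) ∧ 0 < volume (B ∩ Ici c) := by
  have hf : ∀ b : ℝ, ∃ᵐ x ∂(volume.restrict B), id x ≠ b := by
    intro b hb
    have h1 : (volume.restrict B) univ = 0 := by
      have h2 : (volume.restrict B) {b}ᶜ = 0 := by simpa [ae_iff, compl_def] using hb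
      rw [← compl_union_self {b}]
      exact measure_union_null h2 (by simp)
    simp [h] at h1
  obtain ⟨a, b, hab, ha, hb⟩ := exists_ne_forall_mem_nhds_pos_measure_preimage hf
  simp only [preimage_id] at ha hb
  wlog hlt : a < b generalizing a b
  · exact this b a hab.symm hb ha (lt_of_le_of_ne (not_lt.1 hlt) hab.symm)
  obtain ⟨c, hac, hcb⟩ := exists_between hlt
  refine ⟨c, ?_, ?_⟩
  · simpa [Measure.restrict_apply measurableSet_Iio, inter_comm] using ha _ (Iio_mem_nhds hac)
  · simpa [Measure.restrict_apply measurableSet_Ici, inter_comm] using hb _ (Ici_mem_nhds hcb)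

namespace IntervalFamily

/-- The points covered infinitely often at scales in the linear ranges of the gauge form a null
set, if the total lengths are small enough. -/
theorem gaugeHausdorff_frequently_block_eq_zero {Z : ℕ → IntervalFamily} {N : ℕ → ℕ}
    {U : ℕ → Set ℝ} (h : ∀ n, Refines (Z n) (Z (n + 1)) (N n) (U n)) {I : ℕ → Set ℝ}
    {ℓ : ℕ → ℝ≥0} (hI : ∀ k, Metric.ediam (I k) ≤ ℓ k) (hℓ : Summable ℓ) {s e : ℕ → ℕ}
    (hs : ∀ m, m ≤ s m) (htail : ∀ m, (Z m).density * ∑' k, (ℓ (k + s m) : ℝ) ≤ (1 / 2) ^ m)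
    (hlen : ∀ m k, s m ≤ k → k < e m → (Z m).len / N m ≤ ℓ k) :
    gaugeHausdorff (gauge Z)
      {x | ∃ᶠ m in atTop, ∃ k ∈ Finset.Ico (s m) (e m), x ∈ I k} = 0 := by
  refine gaugeHausdorff_frequently_eq_zero (isGauge_gauge Z).mono hI hℓ
    (fun m k hk => (hs m).trans (Finset.mem_Ico.1 hk).1) ?_
  -- On the block the gauge is at most linear, so its sum is at most the density times a tail of
  -- `ℓ`.
  have hblock : ∀ m, ∑ k ∈ Finset.Ico (s m) (e m), (gauge Z (ℓ k) : ℝ) ≤ (1 / 2) ^ m := by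
    intro m
    refine le_trans ?_ (htail m)
    calc ∑ k ∈ Finset.Ico (s m) (e m), (gauge Z (ℓ k) : ℝ)
        ≤ ∑ k ∈ Finset.Ico (s m) (e m), (Z m).density * (ℓ k : ℝ) :=
          Finset.sum_le_sum fun k hk => gauge_le_density_mul h m
            (hlen m k (Finset.mem_Ico.1 hk).1 (Finset.mem_Ico.1 hk).2)
      _ = (Z m).density * ∑ k ∈ Finset.range (e m - s m), (ℓ (k + s m) : ℝ) := by
          rw [← Finset.mul_sum, Finset.sum_Ico_eq_sum_range]
          simp only [add_comm]
      _ ≤ _ := by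
          refine mul_le_mul_of_nonneg_left ?_ (Z m).density_pos.le
          refine Summable.sum_le_tsum _ (fun k _ => (ℓ _).coe_nonneg) ?_
          exact (summable_nat_add_iff (s m)).2 (NNReal.summable_coe.2 hℓ)
  have hblock' : ∀ m, ∑ k ∈ Finset.Ico (s m) (e m), (gauge Z (ℓ k) : ℝ≥0∞) ≤
      (((1 / 2 : ℝ≥0) ^ m : ℝ≥0) : ℝ≥0∞) := by
    intro m
    have : ∑ k ∈ Finset.Ico (s m) (e m), gauge Z (ℓ k) ≤ (1 / 2 : ℝ≥0) ^ m := by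
      rw [← NNReal.coe_le_coe]
      simpa using hblock m
    exact_mod_cast this
  refine ne_top_of_le_ne_top ?_ (ENNReal.tsum_le_tsum hblock')
  exact ENNReal.tsum_coe_ne_top_iff_summable.2
    (NNReal.summable_geometric (by rw [div_lt_one] <;> norm_num))

/-- The family that consists of the interval `[x, x + r]` alone. -/
def single (x r : ℝ) (hr : 0 < r) : IntervalFamily where
  left := {x}
  len := r
  len_pos := hr
  nonempty := Finset.singleton_nonempty x
  sep := by simp

theorem carrier_single (x r : ℝ) (hr : 0 < r) : (single x r hr).carrier = Icc x (x + r) := by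
  simp [carrier, single]

/-- A set that contains the limit set of a scheme and exceeds it by a null set is measured by the
gauge of the scheme. -/
theorem measuredByHausdorff_of_limitSet_subset {Z : ℕ → IntervalFamily} {N : ℕ → ℕ}
    {U : ℕ → Set ℝ} (h : ∀ n, Refines (Z n) (Z (n + 1)) (N n) (U n)) (hN : ∀ n, 2 ≤ N n)
    {A D : Set ℝ} (hA : limitSet Z ⊆ A) (hAD : A ⊆ limitSet Z ∪ D)
    (hD : gaugeHausdorff (gauge Z) D = 0) : MeasuredByHausdorff A := by
  refine ⟨gauge Z, isGauge_gauge Z, gauge_zero h hN,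
    (gaugeHausdorff_limitSet_pos h hN).trans_le (measure_mono hA), ?_⟩
  have hfin : gaugeHausdorff (gauge Z) A < ∞ := by
    refine (measure_mono hAD).trans_lt ((measure_union_le _ _).trans_lt ?_)
    rw [hD, add_zero]
    exact (gaugeHausdorff_limitSet_le h).trans_lt ENNReal.one_lt_top
  have : IsFiniteMeasure ((gaugeHausdorff (gauge Z)).restrict A) :=
    ⟨by rwa [Measure.restrict_apply_univ]⟩
  infer_instance

end IntervalFamily

/-! ### Splitting a non-meagre Borel set -/

/-- A non-meagre Borel set of reals contains the part of a dense `Gδ` set in some interval. -/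
theorem exists_iInter_inter_Ioo_subset {B : Set ℝ} (hB : MeasurableSet B) (hcat : ¬ IsMeagre B) :
    ∃ (U : ℕ → Set ℝ) (a b : ℝ), (∀ n, IsOpen (U n)) ∧ (∀ n, Dense (U n)) ∧ a < b ∧
      (⋂ n, U n) ∩ Ioo a b ⊆ B := by
  -- The Baire property: `B` agrees with the open set `u` off a meagre set, so `u` is nonempty.
  obtain ⟨u, hu, hBu⟩ := hB.residualEq_isOpen
  obtain ⟨t, ht, htG, htd⟩ := mem_residual.1 hBu
  obtain ⟨U, hU, rfl⟩ := isGδ_iff_eq_iInter_nat.1 htG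
  have hne : u.Nonempty := by
    by_contra hne
    rw [not_nonempty_iff_eq_empty] at hne
    subst hne
    refine hcat ?_
    filter_upwards [hBu] with x hx hxB
    exact (Eq.mp hx hxB : x ∈ (∅ : Set ℝ))
  obtain ⟨x, hx⟩ := hne
  obtain ⟨a, b, hab, hsub⟩ := mem_nhds_iff_exists_Ioo_subset.1 (hu.mem_nhds hx)
  refine ⟨U, a, b, hU, fun n => htd.mono (iInter_subset _ n), hab.1.trans hab.2, ?_⟩
  rintro y ⟨hyU, hyI⟩
  exact Eq.mpr (ht hyU) (hsub hyI)

open IntervalFamily in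
theorem exists_split_of_volume_eq_zero {B : Set ℝ} (hB : MeasurableSet B) (hcat : ¬ IsMeagre B)
    (h0 : volume B = 0) :
    ∃ B₁ B₂ : Set ℝ, MeasurableSet B₁ ∧ MeasurableSet B₂ ∧ Disjoint B₁ B₂ ∧ B = B₁ ∪ B₂ ∧
      MeasuredByHausdorff B₁ ∧ MeasuredByHausdorff B₂ := by
  obtain ⟨U, a, b, hU, hd, hab, hUB⟩ := exists_iInter_inter_Ioo_subset hB hcat
  obtain ⟨I, ℓ, hℓ, hsum, hI, hBI⟩ := exists_frequently_mem_of_volume_eq_zero h0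
  -- The two schemes start from the second and the fourth fifth of `(a, b)`, which keeps the limit
  -- sets disjoint and inside the interval.
  have hr : 0 < (b - a) / 5 := by linarith
  obtain ⟨Z, N, t, hZ0, hZ1, hN, ht, href, htail, hlen⟩ := exists_interleaved hℓ hU hd
    (single (a + (b - a) / 5) ((b - a) / 5) hr) (single (a + 3 * ((b - a) / 5)) ((b - a) / 5) hr)
  have href' : ∀ j < 2, ∀ m,
      Refines (Z (2 * m + j)) (Z (2 * (m + 1) + j)) (N (2 * m + j)) (U m) := by
    intro j hj m
    have h := href (2 * m + j)
    rwa [show (2 * m + j) / 2 = m by omega, show 2 * m + j + 2 = 2 * (m + 1) + j by ring] at h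
  set M : ℕ → Set ℝ := fun j => limitSet fun m => Z (2 * m + j) with hM
  set D : ℕ → Set ℝ := fun j =>
    {x | ∃ᶠ m in atTop, ∃ k ∈ Finset.Ico (t (2 * m + j)) (t (2 * m + j + 1)), x ∈ I k} with hDdef
  have hD : ∀ j < 2, gaugeHausdorff (gauge fun m => Z (2 * m + j)) (D j) = 0 := by
    intro j hj
    refine gaugeHausdorff_frequently_block_eq_zero (N := fun m => N (2 * m + j)) (href' j hj) hI
      hsum (fun m => le_trans (by omega) (ht.le_apply)) (fun m => (htail _).trans ?_)
      (fun m k => hlen _ k)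
    exact pow_le_pow_of_le_one (by norm_num) (by norm_num) (by omega)
  have hBD : B ⊆ D 0 ∪ D 1 := by
    intro x hx
    -- Blocks are finite, so infinitely many `k` means infinitely many blocks, and one parity must
    -- recur.
    have h1 : ∃ᶠ n in atTop, ∃ k ∈ Finset.Ico (t n) (t (n + 1)), x ∈ I k := by
      refine frequently_atTop.2 fun n => ?_
      obtain ⟨k, hk, hxk⟩ := frequently_atTop.1 (hBI x hx) (t n)
      have hex : ∃ m, k < t m := ⟨k + 1, (Nat.lt_succ_self k).trans_le ht.le_apply⟩
      classical
      obtain ⟨m, hm⟩ : ∃ m, Nat.find hex = m + 1 := Nat.exists_eq_succ_of_ne_zero fun h => by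
        have := Nat.find_spec hex
        rw [h] at this
        exact absurd (hk.trans_lt this) (not_lt.2 (ht.monotone (Nat.zero_le n)))
      have h2 : k < t (m + 1) := hm ▸ Nat.find_spec hex
      have h3 : t m ≤ k := not_lt.1 (Nat.find_min hex (by omega))
      exact ⟨m, Nat.lt_succ_iff.1 (ht.lt_iff_lt.1 (hk.trans_lt h2)), k,
        Finset.mem_Ico.2 ⟨h3, h2⟩, hxk⟩
    by_contra hcon
    simp only [hDdef, mem_union, mem_ofPred_eq, not_or, not_frequently, eventually_atTop] at hcon
    obtain ⟨⟨n₀, h₀⟩, n₁, h₁⟩ := hcon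
    obtain ⟨n, hn, hk⟩ := frequently_atTop.1 h1 (2 * (n₀ + n₁) + 1)
    rcases Nat.even_or_odd' n with ⟨m, rfl | rfl⟩
    · exact h₀ m (by omega) hk
    · exact h₁ m (by omega) hk
  have hM0 : M 0 ⊆ Icc (a + (b - a) / 5) (a + 2 * ((b - a) / 5)) := by
    refine (iInter_subset _ 0).trans ?_
    simp only [mul_zero, zero_add, hZ0, carrier_single]
    exact Icc_subset_Icc_right (by linarith)
  have hM1 : M 1 ⊆ Icc (a + 3 * ((b - a) / 5)) (a + 4 * ((b - a) / 5)) := by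
    refine (iInter_subset _ 0).trans ?_
    simp only [mul_zero, zero_add, hZ1, carrier_single]
    exact Icc_subset_Icc_right (by linarith)
  have hM0B : M 0 ⊆ B := fun x hx => hUB ⟨limitSet_subset (href' 0 (by norm_num)) hx,
    by linarith [(hM0 hx).1], by linarith [(hM0 hx).2]⟩
  have hM1B : M 1 ⊆ B := fun x hx => hUB ⟨limitSet_subset (href' 1 (by norm_num)) hx,
    by linarith [(hM1 hx).1], by linarith [(hM1 hx).2]⟩
  have hdisj : ∀ x ∈ M 0, x ∉ M 1 := fun x h h' => by linarith [(hM0 h).2, (hM1 h').1]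
  have hMm : ∀ j, MeasurableSet (M j) := fun j => (isCompact_limitSet _).measurableSet
  -- The sets `I k` are arbitrary, so `D 0` need not be Borel; a measurable hull is equally null.
  set E := toMeasurable (gaugeHausdorff (gauge fun m => Z (2 * m + 0))) (D 0) with hE
  have hE0 : gaugeHausdorff (gauge fun m => Z (2 * m + 0)) E = 0 := by
    rw [hE, measure_toMeasurable, hD 0 (by norm_num)]
  have hB1m : MeasurableSet (M 0 ∪ (B ∩ E) \ M 1) :=
    (hMm 0).union ((hB.inter (measurableSet_toMeasurable _ _)).diff (hMm 1))
  -- `M 1` is left to the second piece; the rest of that piece avoids `D 0` and so lies in `D 1`.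
  refine ⟨M 0 ∪ (B ∩ E) \ M 1, B \ (M 0 ∪ (B ∩ E) \ M 1), hB1m, hB.diff hB1m,
    disjoint_sdiff_right, ?_, ?_, ?_⟩
  · rw [union_sdiff_self, eq_comm, union_eq_right]
    exact union_subset hM0B (sdiff_subset.trans inter_subset_left)
  · exact measuredByHausdorff_of_limitSet_subset (href' 0 (by norm_num)) (fun m => hN _)
      subset_union_left (union_subset_union_right _ (sdiff_subset.trans inter_subset_right)) hE0
  · refine measuredByHausdorff_of_limitSet_subset (href' 1 (by norm_num)) (fun m => hN _)
      (fun x hx => ⟨hM1B hx, ?_⟩) ?_ (hD 1 (by norm_num))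
    · rintro (h | h)
      · exact hdisj x h hx
      · exact h.2 hx
    · rintro x ⟨hxB, hx⟩
      by_cases hx1 : x ∈ M 1
      · exact Or.inl hx1
      · refine Or.inr ((hBD hxB).resolve_left fun h => hx (Or.inr ⟨⟨hxB, ?_⟩, hx1⟩))
        exact subset_toMeasurable _ _ h

theorem corollary2p5 (B : Set ℝ) (hB : MeasurableSet B) (hcat : ¬ IsMeagre B) :
    ∃ B₁ B₂ : Set ℝ, MeasurableSet B₁ ∧ MeasurableSet B₂ ∧ Disjoint B₁ B₂ ∧ B = B₁ ∪ B₂ ∧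
      MeasuredByHausdorff B₁ ∧ MeasuredByHausdorff B₂ := by
  by_cases h0 : volume B = 0
  · exact exists_split_of_volume_eq_zero hB hcat h0
  · obtain ⟨c, h1, h2⟩ := exists_split_of_volume_pos h0
    refine ⟨B ∩ Iio c, B ∩ Ici c, hB.inter measurableSet_Iio, hB.inter measurableSet_Ici, ?_, ?_,
      measuredByHausdorff_of_volume_pos h1, measuredByHausdorff_of_volume_pos h2⟩
    · exact disjoint_left.2 fun x hx hx' => not_lt.2 (mem_Ici.1 hx'.2) (mem_Iio.1 hx.2)
    · rw [← inter_union_distrib_left, Iio_union_Ici, inter_univ]
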